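/- Let $k_1,k_2\in\mathbb{R}$ with $k_1>0$, $k_2<0$ and $k_1+4k_2>0$, and let $M<N$ be nonnegative integers. Put $\Lambda^{a}=\{-M,\dots,M\}$ (atomistic domain) and $\Lambda^{c}=\{-N,\dots,-M-1\}\cup\{M+1,\dots,N\}$ (continuum domain). Let $\mathcal{L}_{\mathrm{hnl}}$ and $\mathcal{L}_{\mathrm{h}}$ be the linear operators with kernels $K_{\mathrm{hnl}}(\xi-\eta)$ and $K_{\mathrm{h}}(\xi-\eta)$, $\xi,\eta\in\mathbb{Z}$, where $$K_{\mathrm{hnl}}(0)=2(k_1+k_2),\quad K_{\mathrm{hnl}}(\pm1)=-k_1,\quad K_{\mathrm{hnl}}(\pm2)=-k_2,\qquad K_{\mathrm{h}}(0)=2\bar k,\quad K_{\mathrm{h}}(\pm1)=-\bar k,\quad \bar k=k_1+4k_2,$$ and all other values are zero. The force-based coupled operator acts as $\mathcal{L}_{\mathrm{hnl}}$ in $\Lambda^a$ and as $\mathcal{L}_{\mathrm{h}}$ in $\Lambda^c$, with displacements prescribed outside $\Lambda^a\cup\Lambda^c$. For $x,y\in\{a,c\}$ denote by $\mathcal{L}^{x|y}$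 the block mapping functions on $\Lambda^y$ to functions on $\Lambda^x$, and let $\mathcal{S}=\mathcal{L}_{\mathrm{h}}^{c|c}-\mathcal{L}_{\mathrm{h}}^{c|a}(\mathcal{L}_{\mathrm{h}}^{a|a})^{-1}\mathcal{L}_{\mathrm{h}}^{a|c}$. The iteration operator of the Sinclair method, which maps the error $u-u_k$ to $u-u_{k+1}$, is $$\mathcal{P}=\mathcal{I}-\mathcal{P}_a-\mathcal{P}_c+\mathcal{P}_c\mathcal{P}_a,\qquad \mathcal{P}_a=\begin{pmatrix}\mathcal{I}&(\mathcal{L}_{\mathrm{hnl}}^{a|a})^{-1}\mathcal{L}_{\mathrm{hnl}}^{a|c}\\0&0\end{pmatrix},\qquad \mathcal{P}_c=\begin{pmatrix}0&0\\\mathcal{S}^{-1}\mathcal{L}_{\mathrm{h}}^{c|a}&\mathcal{S}^{-1}\mathcal{L}_{\mathrm{h}}^{c|c}\end{pmatrix}.$$ Then $\mathcal{L}_{\mathrm{hnl}}^{a|a}$, $\mathcal{L}_{\mathrm{h}}^{a|a}$ and $\mathcal{S}$ are invertible, so that $\mathcal{P}$ is well defined, and the spectral radius $\sigma(\mathcal{P})$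 (the largest modulus of a complex eigenvalue) satisfies $\sigma(\mathcal{P})<1$. -/

import Mathlib

noncomputable section

namespace Sinclair

/-- The atomistic domain `{-M, …, M} ⊆ ℤ`. -/
def atomDom (M : ℕ) : Finset ℤ :=
  Finset.Icc (-(M : ℤ)) (M : ℤ)

/-- The continuum domain `{-N, …, -M-1} ∪ {M+1, …, N} ⊆ ℤ`. -/
def contDom (M N : ℕ) : Finset ℤ :=
  Finset.Icc (-(N : ℤ)) (-(M : ℤ) - 1) ∪ Finset.Icc ((M : ℤ) + 1) (N : ℤ)

/-- Second-neighbour atomistic stencil: `K_hnl(ξ - η)` as a function of `z = ξ - η`. -/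
def stencilHnl (k₁ k₂ : ℝ) (z : ℤ) : ℝ :=
  if |z| = 2 then -k₂
  else if |z| = 1 then -k₁
  else if |z| = 0 then 2 * (k₁ + k₂)
  else 0

/-- Nearest-neighbour continuum stencil `K_h(ξ - η)`, with stiffness `k₁ + 4 k₂`. -/
def stencilH (k₁ k₂ : ℝ) (z : ℤ) : ℝ :=
  if |z| = 1 then -(k₁ + 4 * k₂)
  else if |z| = 0 then 2 * (k₁ + 4 * k₂)
  else 0

/-- The block of the convolution operator with kernel `K` that takes functions on `B` (extended by
zero to `ℤ`) to functions on `A`. -/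
def block (K : ℤ → ℝ) (A B : Finset ℤ) : Matrix A B ℝ :=
  Matrix.of fun ξ η => K ((ξ : ℤ) - (η : ℤ))

/-- The atomistic Hessian on the atomistic domain. -/
def hnlAA (k₁ k₂ : ℝ) (M : ℕ) : Matrix (atomDom M) (atomDom M) ℝ :=
  block (stencilHnl k₁ k₂) (atomDom M) (atomDom M)

/-- The coupling block of the atomistic operator, from continuum to atomistic sites. -/
def hnlAC (k₁ k₂ : ℝ) (M N : ℕ) : Matrix (atomDom M) (contDom M N) ℝ :=
  block (stencilHnl k₁ k₂) (atomDom M) (contDom M N)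

/-- The block of the harmonic operator on the atomistic domain. The four blocks `hAA`, `hAC`, `hCA`,
`hCC` make up the harmonic operator on `{-N, …, N}` with homogeneous Dirichlet condition outside. -/
def hAA (k₁ k₂ : ℝ) (M : ℕ) : Matrix (atomDom M) (atomDom M) ℝ :=
  block (stencilH k₁ k₂) (atomDom M) (atomDom M)

/-- The block of the harmonic operator from continuum to atomistic sites. -/
def hAC (k₁ k₂ : ℝ) (M N : ℕ) : Matrix (atomDom M) (contDom M N) ℝ :=
  block (stencilH k₁ k₂) (atomDom M) (contDom M N)

/-- The block of the harmonic operator from atomistic to continuum sites. -/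
def hCA (k₁ k₂ : ℝ) (M N : ℕ) : Matrix (contDom M N) (atomDom M) ℝ :=
  block (stencilH k₁ k₂) (contDom M N) (atomDom M)

/-- The block of the harmonic operator on the continuum domain. -/
def hCC (k₁ k₂ : ℝ) (M N : ℕ) : Matrix (contDom M N) (contDom M N) ℝ :=
  block (stencilH k₁ k₂) (contDom M N) (contDom M N)

/-- The Schur complement of the atomistic block in the harmonic operator. Its inverse is the
continuum-continuum block of the inverse of the global harmonic operator. -/
def schurCC (k₁ k₂ : ℝ) (M N : ℕ) : Matrix (contDom M N) (contDom M N) ℝ :=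
  hCC k₁ k₂ M N - hCA k₁ k₂ M N * (hAA k₁ k₂ M)⁻¹ * hAC k₁ k₂ M N

/-- Correction by the local anharmonic (atomistic) solve: `u_{k+1/2} = u_k + P_a (u - u_k)`. -/
def corrA (k₁ k₂ : ℝ) (M N : ℕ) :
    Matrix (atomDom M ⊕ contDom M N) (atomDom M ⊕ contDom M N) ℝ :=
  Matrix.fromBlocks 1 ((hnlAA k₁ k₂ M)⁻¹ * hnlAC k₁ k₂ M N) 0 0

/-- Correction by the global harmonic solve: `u_{k+1} = u_{k+1/2} + P_c (u - u_{k+1/2})`. -/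
def corrC (k₁ k₂ : ℝ) (M N : ℕ) :
    Matrix (atomDom M ⊕ contDom M N) (atomDom M ⊕ contDom M N) ℝ :=
  Matrix.fromBlocks 0 0
    ((schurCC k₁ k₂ M N)⁻¹ * hCA k₁ k₂ M N) ((schurCC k₁ k₂ M N)⁻¹ * hCC k₁ k₂ M N)

/-- The iteration operator `I - P_a - P_c + P_c P_a` of the Sinclair method, which maps the error
`u - u_k` to the error `u - u_{k+1}`. -/
def iterOp (k₁ k₂ : ℝ) (M N : ℕ) :
    Matrix (atomDom M ⊕ contDom M N) (atomDom M ⊕ contDom M N) ℝ :=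
  1 - corrA k₁ k₂ M N - corrC k₁ k₂ M N + corrC k₁ k₂ M N * corrA k₁ k₂ M N

/-- Block form of the iteration operator. -/
theorem iterOp_eq_fromBlocks (k₁ k₂ : ℝ) (M N : ℕ) :
    iterOp k₁ k₂ M N =
      Matrix.fromBlocks 0 (-((hnlAA k₁ k₂ M)⁻¹ * hnlAC k₁ k₂ M N)) 0
        (1 - (schurCC k₁ k₂ M N)⁻¹ * (hCC k₁ k₂ M N -
          hCA k₁ k₂ M N * (hnlAA k₁ k₂ M)⁻¹ * hnlAC k₁ k₂ M N)) := by
  unfold iterOp corrA corrC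
  rw [← Matrix.fromBlocks_one, Matrix.fromBlocks_multiply, sub_eq_add_neg, sub_eq_add_neg,
    Matrix.fromBlocks_neg, Matrix.fromBlocks_neg, Matrix.fromBlocks_add, Matrix.fromBlocks_add,
    Matrix.fromBlocks_add]
  congr 1
  · simp
  · simp
  · simp
  · simp only [Matrix.mul_sub, Matrix.mul_assoc, Matrix.mul_zero, neg_zero, add_zero]
    abel

/-- The spectral radius of a real square matrix: the largest modulus of its complex eigenvalues. -/
def specRad {n : Type} [Fintype n] [DecidableEq n] (A : Matrix n n ℝ) : ENNReal :=
  spectralRadius ℂ (A.map (algebraMap ℝ ℂ))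

end Sinclair

end

namespace Sinclair

open Matrix

/-! Suppose `1 ≤ ‖μ‖` and `v` is the continuum part of an eigenvector. Extend `v` into the atomistic
domain in two ways: harmonically, to `U`, and by the second-neighbour equation, to `W`. Multiplying
the eigenvalue equation by the Schur complement turns it into `μ Δ U = Δ (U - W)` on the continuum
domain.

`U` is affine on `{-M-1, …, M+1}`. Continuing it affinely to `±(M+2)` and subtracting `W` gives a
solution `z` of the second-neighbour equation with `z (±(M+1)) = 0`, and the eigenvalue equation at
`±(M+1)` reads `z (±M) = -μ z (±(M+2))`. The energy estimate `energy_seq` bounds `∑ |Δ z|²` by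
`|z|²` summed over `±(M+2)` minus `|z|²` summed over `±M`, which is at most zero here. Hence `z = 0`
and `U = W` (`eq_of_interface`). Then `Δ U = 0` on `{-N, …, N}`, and the Dirichlet condition forces
`v = 0`. -/

/-! ### Blocks as difference operators on `ℤ`. -/

/-- The discrete Laplacian on `ℤ`. -/
def lap (u : ℤ → ℂ) (x : ℤ) : ℂ := u (x + 1) - 2 * u x + u (x - 1)

/-- The second-neighbour operator on `ℤ`. -/
def hnlOp (k₁ k₂ : ℝ) (u : ℤ → ℂ) (x : ℤ) : ℂ :=
  -k₁ * lap u x - k₂ * (u (x + 2) - 2 * u x + u (x - 2))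

/-- Extension by zero from a finite set of sites to `ℤ`. -/
def extend (A : Finset ℤ) (v : A → ℂ) (x : ℤ) : ℂ :=
  if h : x ∈ A then v ⟨x, h⟩ else 0

theorem extend_of_notMem {A : Finset ℤ} (v : A → ℂ) {x : ℤ} (h : x ∉ A) : extend A v x = 0 :=
  dif_neg h

theorem extend_coe {A : Finset ℤ} (v : A → ℂ) (x : A) : extend A v x = v x := by
  simp [extend]

theorem eq_zero_of_extend {A : Finset ℤ} {v : A → ℂ} (h : ∀ x ∈ A, extend A v x = 0) : v = 0 := by
  funext x
  rw [← extend_coe v x, h x x.2, Pi.zero_apply]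

theorem block_mulVec (K : ℤ → ℝ) (A B : Finset ℤ) (v : B → ℂ) (ξ : A) :
    ((block K A B).map (algebraMap ℝ ℂ) *ᵥ v) ξ
      = ∑ η ∈ B, (K ((ξ : ℤ) - η) : ℂ) * extend B v η := by
  rw [← Finset.sum_coe_sort B]
  simp [Matrix.mulVec, dotProduct, block, extend_coe]

theorem sum_ite_mul_extend (B : Finset ℤ) (v : B → ℂ) (a : ℤ) (c : ℂ) :
    ∑ η ∈ B, (if η = a then c else 0) * extend B v η = c * extend B v a := by
  simp only [ite_mul, zero_mul, Finset.sum_ite_eq']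
  split_ifs with h
  · rfl
  · rw [extend_of_notMem v h, mul_zero]

/-- Through zero extension, every block identity becomes a pointwise difference equation. -/
theorem stencilH_mulVec (k₁ k₂ : ℝ) (A B : Finset ℤ) (v : B → ℂ) (ξ : A) :
    ((block (stencilH k₁ k₂) A B).map (algebraMap ℝ ℂ) *ᵥ v) ξ
      = -(k₁ + 4 * k₂) * lap (extend B v) ξ := by
  have key : ∀ η : ℤ, (stencilH k₁ k₂ ((ξ : ℤ) - η) : ℂ)
      = (if η = (ξ : ℤ) + 1 then (-(k₁ + 4 * k₂) : ℂ) else 0)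
        + (if η = (ξ : ℤ) then (2 * (k₁ + 4 * k₂) : ℂ) else 0)
        + (if η = (ξ : ℤ) - 1 then (-(k₁ + 4 * k₂) : ℂ) else 0) := by
    intro η
    simp only [stencilH, Int.abs_eq_natAbs]
    split_ifs <;> first | omega | (push_cast; ring)
  simp only [block_mulVec, key, add_mul _ _ (extend B v _), Finset.sum_add_distrib,
    sum_ite_mul_extend, lap]
  ring

theorem stencilHnl_mulVec (k₁ k₂ : ℝ) (A B : Finset ℤ) (v : B → ℂ) (ξ : A) :
    ((block (stencilHnl k₁ k₂) A B).map (algebraMap ℝ ℂ) *ᵥ v) ξ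
      = hnlOp k₁ k₂ (extend B v) ξ := by
  have key : ∀ η : ℤ, (stencilHnl k₁ k₂ ((ξ : ℤ) - η) : ℂ)
      = (if η = (ξ : ℤ) + 2 then (-k₂ : ℂ) else 0)
        + (if η = (ξ : ℤ) + 1 then (-k₁ : ℂ) else 0)
        + (if η = (ξ : ℤ) then (2 * (k₁ + k₂) : ℂ) else 0)
        + (if η = (ξ : ℤ) - 1 then (-k₁ : ℂ) else 0)
        + (if η = (ξ : ℤ) - 2 then (-k₂ : ℂ) else 0) := by
    intro η
    simp only [stencilHnl, Int.abs_eq_natAbs]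
    split_ifs <;> first | omega | (push_cast; ring)
  simp only [block_mulVec, key, add_mul _ _ (extend B v _), Finset.sum_add_distrib,
    sum_ite_mul_extend, lap, hnlOp]
  ring

theorem lap_add (u v : ℤ → ℂ) (x : ℤ) : lap (u + v) x = lap u x + lap v x := by
  simp only [lap, Pi.add_apply]; ring

theorem lap_sub (u v : ℤ → ℂ) (x : ℤ) : lap (u - v) x = lap u x - lap v x := by
  simp only [lap, Pi.sub_apply]; ring

theorem hnlOp_add (k₁ k₂ : ℝ) (u v : ℤ → ℂ) (x : ℤ) :
    hnlOp k₁ k₂ (u + v) x = hnlOp k₁ k₂ u x + hnlOp k₁ k₂ v x := by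
  simp only [hnlOp, lap, Pi.add_apply]; ring

/-! ### Dirichlet uniqueness and the energy estimate. -/

/-- Uniqueness for the Dirichlet problem of the discrete Laplacian. -/
theorem eq_zero_of_lap_eq_zero (R : ℕ) (u : ℤ → ℂ) (hl : u (-R - 1) = 0) (hr : u (R + 1) = 0)
    (h : ∀ x : ℤ, -R ≤ x → x ≤ R → lap u x = 0) :
    ∀ x : ℤ, -R - 1 ≤ x → x ≤ R + 1 → u x = 0 := by
  -- A solution is affine from the left boundary zero, with slope `u (-R)`; the right boundary zero
  -- then kills the slope. Two consecutive values are carried because the recurrence has order two.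
  have lin : ∀ n : ℕ, n ≤ 2 * R + 1 →
      u (-R - 1 + n) = n * u (-R) ∧ u (-R - 1 + (n + 1)) = (n + 1) * u (-R) := by
    intro n
    induction n with
    | zero =>
      intro _
      refine ⟨by simpa using hl, ?_⟩
      have : (-(R : ℤ) - 1 + ((0 : ℕ) + 1)) = -R := by push_cast; ring
      rw [this]; simp
    | succ n ih =>
      intro hn
      obtain ⟨h1, h2⟩ := ih (by omega)
      have h3 := h (-R - 1 + (n + 1)) (by omega) (by omega)
      have e1 : (-(R : ℤ) - 1 + (n + 1)) + 1 = -R - 1 + ((n + 1) + 1) := by ring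
      have e2 : (-(R : ℤ) - 1 + (n + 1)) - 1 = -R - 1 + n := by ring
      rw [lap, e1, e2, h1, h2] at h3
      push_cast
      exact ⟨h2, by linear_combination h3⟩
  have h0 : u (-R) = 0 := by
    have := (lin (2 * R + 1) le_rfl).2
    have e : (-(R : ℤ) - 1 + (((2 * R + 1 : ℕ) : ℤ) + 1)) = R + 1 := by push_cast; ring
    rw [e, hr] at this
    refine (mul_eq_zero.1 this.symm).resolve_left ?_
    exact_mod_cast Nat.succ_ne_zero (2 * R + 1)
  intro x hx hx'
  rcases eq_or_lt_of_le hx' with rfl | hlt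
  · exact hr
  · obtain ⟨n, hn⟩ := Int.eq_ofNat_of_zero_le (show 0 ≤ x - (-R - 1) by omega)
    have := (lin n (by omega)).1
    rw [h0, mul_zero] at this
    rwa [show x = -R - 1 + n by omega]

/-- Green's second identity for a sequence and its second difference. -/
theorem sum_green (Z y : ℕ → ℝ) (hy : ∀ i, y i = Z i - 2 * Z (i + 1) + Z (i + 2)) (n : ℕ) :
    ∑ i ∈ Finset.range n, (Z (i + 2) * (y i - 2 * y (i + 1) + y (i + 2)) - y (i + 1) ^ 2)
      = Z (n + 1) * y (n + 1) - y n * Z (n + 2) - (Z 1 * y 1 - y 0 * Z 2) := by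
  induction n with
  | zero => simp
  | succ n ih =>
    rw [Finset.sum_range_succ, ih]
    linear_combination (-y (n + 1)) * hy (n + 1)

theorem sum_mul_secondDiff (Z : ℕ → ℝ) (n : ℕ) :
    ∑ i ∈ Finset.range n, Z (i + 2) * (Z (i + 1) - 2 * Z (i + 2) + Z (i + 3))
      = Z (n + 1) * (Z (n + 2) - Z (n + 1)) - Z 1 * (Z 2 - Z 1)
        - ∑ i ∈ Finset.range n, (Z (i + 2) - Z (i + 1)) ^ 2 := by
  induction n with
  | zero => simp
  | succ n ih =>
    rw [Finset.sum_range_succ, ih, Finset.sum_range_succ]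
    ring

/-- The second-neighbour difference is `Δ² + 4Δ`, so the equation reads `-k₂ Δ² Z = (k₁ + 4 k₂) Δ
Z`. Testing with `Z`, which vanishes at both ends, gives `∑ Z Δ² Z ≤ 0` since both coefficients are
positive; Green's identity converts this into a bound on `∑ (Δ Z)²` by boundary terms. -/
theorem energy_seq {k₁ k₂ : ℝ} (hk₂ : k₂ < 0) (hk : 0 < k₁ + 4 * k₂) (n : ℕ) (Z : ℕ → ℝ)
    (h1 : Z 1 = 0) (h2 : Z (n + 2) = 0)
    (h : ∀ i < n, k₁ * (Z (i + 1) - 2 * Z (i + 2) + Z (i + 3))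
      + k₂ * (Z i - 2 * Z (i + 2) + Z (i + 4)) = 0) :
    ∑ i ∈ Finset.range (n + 2), (Z i - 2 * Z (i + 1) + Z (i + 2)) ^ 2
      ≤ Z (n + 3) ^ 2 + Z 0 ^ 2 - Z (n + 1) ^ 2 - Z 2 ^ 2 := by
  set y : ℕ → ℝ := fun i => Z i - 2 * Z (i + 1) + Z (i + 2) with hy
  have green := sum_green Z y (fun _ => rfl) n
  rw [Finset.sum_sub_distrib] at green
  have hZ := sum_mul_secondDiff Z n
  have hsum : -k₂ * ∑ i ∈ Finset.range n, Z (i + 2) * (y i - 2 * y (i + 1) + y (i + 2))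
      = (k₁ + 4 * k₂) * ∑ i ∈ Finset.range n,
        Z (i + 2) * (Z (i + 1) - 2 * Z (i + 2) + Z (i + 3)) := by
    rw [Finset.mul_sum, Finset.mul_sum]
    refine Finset.sum_congr rfl fun i hi => ?_
    have := h i (Finset.mem_range.1 hi)
    simp only [hy]
    linear_combination (-Z (i + 2)) * this
  have hD : 0 ≤ ∑ i ∈ Finset.range n, (Z (i + 2) - Z (i + 1)) ^ 2 :=
    Finset.sum_nonneg fun _ _ => sq_nonneg _
  have hY : 0 ≤ ∑ i ∈ Finset.range n, y (i + 1) ^ 2 := Finset.sum_nonneg fun _ _ => sq_nonneg _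
  have hneg : ∑ i ∈ Finset.range n, Z (i + 2) * (y i - 2 * y (i + 1) + y (i + 2)) ≤ 0 := by
    have : ∑ i ∈ Finset.range n, Z (i + 2) * (Z (i + 1) - 2 * Z (i + 2) + Z (i + 3)) ≤ 0 := by
      rw [hZ, h1, h2]; nlinarith [sq_nonneg (Z (n + 1))]
    nlinarith [mul_nonneg hk.le (neg_nonneg.2 this)]
  rw [h1, h2] at green
  -- As `Z 1 = 0`, `Z 0 ^ 2 - Z 2 ^ 2 = y 0 ^ 2 - 2 * y 0 * Z 2`, and likewise at the right end: the
  -- Green boundary terms become differences of squares.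
  have e0 : Z 0 = y 0 - Z 2 := by simp only [hy, zero_add, h1]; ring
  have e1 : Z (n + 3) = y (n + 1) - Z (n + 1) := by
    have : y (n + 1) = Z (n + 1) - 2 * Z (n + 2) + Z (n + 3) := rfl
    rw [this, h2]; ring
  have e2 : ∑ i ∈ Finset.range (n + 2), y i ^ 2
      = y 0 ^ 2 + ∑ i ∈ Finset.range n, y (i + 1) ^ 2 + y (n + 1) ^ 2 := by
    rw [Finset.sum_range_succ, Finset.sum_range_succ']; ring
  change ∑ i ∈ Finset.range (n + 2), y i ^ 2 ≤ _
  rw [e0, e1, e2]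
  nlinarith

/-- A solution of the second-neighbour equation on `{-M, …, M}` which vanishes on the first boundary
layer has a larger trace on the second boundary layer than on the outermost sites. -/
theorem eq_zero_of_boundary_le {k₁ k₂ : ℝ} (hk₂ : k₂ < 0) (hk : 0 < k₁ + 4 * k₂) (M : ℕ)
    (z : ℤ → ℂ) (hl : z (-M - 1) = 0) (hr : z (M + 1) = 0)
    (h : ∀ x : ℤ, -M ≤ x → x ≤ M → hnlOp k₁ k₂ z x = 0)
    (hle : ‖z (M + 2)‖ ^ 2 + ‖z (-M - 2)‖ ^ 2 ≤ ‖z M‖ ^ 2 + ‖z (-M)‖ ^ 2) :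
    ∀ x : ℤ, -M - 2 ≤ x → x ≤ M + 2 → z x = 0 := by
  have eqn : ∀ i : ℕ, i < 2 * M + 1 →
      k₁ * (z ((i : ℤ) + 1 - M - 2) - 2 * z (i + 2 - M - 2) + z (i + 3 - M - 2))
      + k₂ * (z (i - M - 2) - 2 * z (i + 2 - M - 2) + z (i + 4 - M - 2)) = 0 := by
    intro i hi
    have := h (i + 2 - M - 2) (by omega) (by omega)
    rw [hnlOp, lap, show (i : ℤ) + 2 - M - 2 + 1 = i + 3 - M - 2 by ring,
      show (i : ℤ) + 2 - M - 2 - 1 = i + 1 - M - 2 by ring,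
      show (i : ℤ) + 2 - M - 2 + 2 = i + 4 - M - 2 by ring,
      show (i : ℤ) + 2 - M - 2 - 2 = i - M - 2 by ring] at this
    linear_combination -this
  have c1 : ((1 : ℕ) : ℤ) - M - 2 = -M - 1 := by push_cast; ring
  have c0 : ((0 : ℕ) : ℤ) - M - 2 = -M - 2 := by push_cast; ring
  have c2 : ((2 : ℕ) : ℤ) - M - 2 = -M := by push_cast; ring
  have d1 : ((2 * M + 1 + 1 : ℕ) : ℤ) - M - 2 = M := by push_cast; ring
  have d2 : ((2 * M + 1 + 2 : ℕ) : ℤ) - M - 2 = M + 1 := by push_cast; ring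
  have d3 : ((2 * M + 1 + 3 : ℕ) : ℤ) - M - 2 = M + 2 := by push_cast; ring
  -- The coefficients are real, so real and imaginary parts satisfy the estimate separately; index
  -- `0` is the site `-M - 2`.
  have hre := energy_seq hk₂ hk (2 * M + 1) (fun i => (z ((i : ℤ) - M - 2)).re)
    (by simp only [c1, hl, Complex.zero_re]) (by simp only [d2, hr, Complex.zero_re])
    (fun i hi => by simpa using congrArg Complex.re (eqn i hi))
  have him := energy_seq hk₂ hk (2 * M + 1) (fun i => (z ((i : ℤ) - M - 2)).im)
    (by simp only [c1, hl, Complex.zero_im]) (by simp only [d2, hr, Complex.zero_im])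
    (fun i hi => by simpa using congrArg Complex.im (eqn i hi))
  simp only [c0, c2, d1, d3] at hre him
  simp only [Complex.sq_norm, Complex.normSq_apply] at hle
  have nre := Finset.sum_nonneg (s := Finset.range (2 * M + 1 + 2)) fun i _ =>
    sq_nonneg ((z ((i : ℤ) - M - 2)).re - 2 * (z (((i + 1 : ℕ) : ℤ) - M - 2)).re
      + (z (((i + 2 : ℕ) : ℤ) - M - 2)).re)
  have nim := Finset.sum_nonneg (s := Finset.range (2 * M + 1 + 2)) fun i _ =>
    sq_nonneg ((z ((i : ℤ) - M - 2)).im - 2 * (z (((i + 1 : ℕ) : ℤ) - M - 2)).im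
      + (z (((i + 2 : ℕ) : ℤ) - M - 2)).im)
  have zre := (Finset.sum_eq_zero_iff_of_nonneg fun i _ => sq_nonneg _).1
    (le_antisymm (by nlinarith) nre)
  have zim := (Finset.sum_eq_zero_iff_of_nonneg fun i _ => sq_nonneg _).1
    (le_antisymm (by nlinarith) nim)
  have hlap : ∀ x : ℤ, -M - 1 ≤ x → x ≤ M + 1 → lap z x = 0 := by
    intro x hx hx'
    obtain ⟨i, hi⟩ := Int.eq_ofNat_of_zero_le (show 0 ≤ x + M + 1 by omega)
    have hmem : i ∈ Finset.range (2 * M + 1 + 2) := Finset.mem_range.2 (by omega)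
    have r := pow_eq_zero_iff two_ne_zero |>.1 (zre i hmem)
    have s := pow_eq_zero_iff two_ne_zero |>.1 (zim i hmem)
    rw [show (i : ℤ) - M - 2 = x - 1 by omega, show ((i + 1 : ℕ) : ℤ) - M - 2 = x by omega,
      show ((i + 2 : ℕ) : ℤ) - M - 2 = x + 1 by omega] at r s
    apply Complex.ext <;> simp [lap] <;> linarith
  have inner := eq_zero_of_lap_eq_zero M z hl hr fun x hx hx' => hlap x (by omega) (by omega)
  have outr := hlap (M + 1) (by omega) le_rfl
  have outl := hlap (-M - 1) le_rfl (by omega)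
  rw [lap, hr, inner (M + 1 - 1) (by omega) (by omega), add_assoc] at outr
  rw [lap, hl, inner (-M - 1 + 1) (by omega) (by omega), sub_sub] at outl
  intro x hx hx'
  rcases eq_or_lt_of_le hx with rfl | hx
  · simpa using outl
  rcases eq_or_lt_of_le hx' with rfl | hx'
  · simpa using outr
  exact inner x (by omega) (by omega)

/-! ### Kernel and eigenvector criteria. -/

theorem isUnit_of_complex_injective {n : Type} [Fintype n] [DecidableEq n] (A : Matrix n n ℝ)
    (h : ∀ v : n → ℂ, A.map (algebraMap ℝ ℂ) *ᵥ v = 0 → v = 0) : IsUnit A := by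
  rw [Matrix.isUnit_iff_isUnit_det, isUnit_iff_ne_zero]
  intro h0
  have : (A.map (algebraMap ℝ ℂ)).det = 0 := by
    have := (algebraMap ℝ ℂ).map_det A
    rw [h0, map_zero] at this
    exact this.symm
  obtain ⟨v, hv, hv'⟩ := Matrix.exists_mulVec_eq_zero_iff.2 this
  exact hv (h v hv')

theorem specRad_lt_one {n : Type} [Fintype n] [DecidableEq n] (A : Matrix n n ℝ)
    (h : ∀ (μ : ℂ) (v : n → ℂ), A.map (algebraMap ℝ ℂ) *ᵥ v = μ • v → 1 ≤ ‖μ‖ → v = 0) :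
    specRad A < 1 := by
  have hlt : ∀ μ ∈ spectrum ℂ (A.map (algebraMap ℝ ℂ)), ‖μ‖ < 1 := by
    intro μ hμ
    by_contra! hc
    rw [← Matrix.spectrum_toLin', ← Module.End.hasEigenvalue_iff_mem_spectrum] at hμ
    obtain ⟨v, hv⟩ := hμ.exists_hasEigenvector
    exact hv.2 (h μ v (by simpa using hv.apply_eq_smul) hc)
  -- Finiteness keeps the inequality strict when passing to the supremum.
  have hfin : (spectrum ℂ (A.map (algebraMap ℝ ℂ))).Finite := by
    rw [← Matrix.spectrum_toLin']
    exact Module.End.finite_spectrum _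
  unfold specRad spectralRadius
  rw [← hfin.coe_toFinset]
  simp only [Finset.mem_coe]
  rw [← Finset.sup_eq_iSup, Finset.sup_lt_iff (by simp)]
  intro μ hμ
  exact_mod_cast hlt μ (hfin.mem_toFinset.1 hμ)

/-! ### Invertibility of the atomistic blocks and of the Schur complement. -/

theorem mem_atomDom {M : ℕ} {x : ℤ} : x ∈ atomDom M ↔ -(M : ℤ) ≤ x ∧ x ≤ M := Finset.mem_Icc

theorem mem_contDom {M N : ℕ} {x : ℤ} :
    x ∈ contDom M N ↔ (-(N : ℤ) ≤ x ∧ x ≤ -M - 1) ∨ (M + 1 ≤ x ∧ x ≤ N) := by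
  simp [contDom]

theorem isUnit_hAA {k₁ k₂ : ℝ} (hk : 0 < k₁ + 4 * k₂) (M : ℕ) : IsUnit (hAA k₁ k₂ M) := by
  have hk' : (k₁ + 4 * k₂ : ℂ) ≠ 0 := by exact_mod_cast hk.ne'
  refine isUnit_of_complex_injective _ fun v hv => eq_zero_of_extend fun x hx => ?_
  rw [mem_atomDom] at hx
  refine eq_zero_of_lap_eq_zero M _ (extend_of_notMem v ?_) (extend_of_notMem v ?_)
    (fun y hy hy' => ?_) x (by omega) (by omega)
  · rw [mem_atomDom]; omega
  · rw [mem_atomDom]; omega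
  · have := congrFun hv ⟨y, mem_atomDom.2 ⟨hy, hy'⟩⟩
    rw [hAA, stencilH_mulVec] at this
    exact (mul_eq_zero.1 this).resolve_left (neg_ne_zero.2 hk')

theorem isUnit_hnlAA {k₁ k₂ : ℝ} (hk₂ : k₂ < 0) (hk : 0 < k₁ + 4 * k₂) (M : ℕ) :
    IsUnit (hnlAA k₁ k₂ M) := by
  refine isUnit_of_complex_injective _ fun v hv => eq_zero_of_extend fun x hx => ?_
  rw [mem_atomDom] at hx
  have out : ∀ y : ℤ, y < -M ∨ M < y → extend _ v y = 0 := fun y hy =>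
    extend_of_notMem v (by rw [mem_atomDom]; omega)
  refine eq_zero_of_boundary_le hk₂ hk M _ (out _ (by omega)) (out _ (by omega))
    (fun y hy hy' => ?_) ?_ x (by omega) (by omega)
  · have := congrFun hv ⟨y, mem_atomDom.2 ⟨hy, hy'⟩⟩
    rwa [hnlAA, stencilHnl_mulVec] at this
  · rw [out (M + 2) (by omega), out (-M - 2) (by omega), norm_zero]
    linarith [sq_nonneg ‖extend _ v M‖, sq_nonneg ‖extend _ v (-M)‖]

/-- The map of a block extension `-A⁻¹ B` solves the inner problem with boundary data `v`. -/
theorem mulVec_extension {m n : Type} [Fintype m] [DecidableEq m] [Fintype n]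
    {A : Matrix m m ℝ} (hA : IsUnit A) (B : Matrix m n ℝ) (v : n → ℂ) :
    A.map (algebraMap ℝ ℂ) *ᵥ (-((A⁻¹ * B).map (algebraMap ℝ ℂ) *ᵥ v))
      + B.map (algebraMap ℝ ℂ) *ᵥ v = 0 := by
  rw [Matrix.mulVec_neg, Matrix.mulVec_mulVec, ← Matrix.map_mul,
    Matrix.mul_nonsing_inv_cancel_left _ _ ((Matrix.isUnit_iff_isUnit_det _).1 hA),
    neg_add_cancel]

/-- Eliminating the atomistic sites amounts to filling them with the harmonic extension of `v`. -/
theorem schurCC_mulVec (k₁ k₂ : ℝ) (M N : ℕ) (v : contDom M N → ℂ) (ξ : contDom M N) :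
    ((schurCC k₁ k₂ M N).map (algebraMap ℝ ℂ) *ᵥ v) ξ = -(k₁ + 4 * k₂) * lap
      (extend _ (-(((hAA k₁ k₂ M)⁻¹ * hAC k₁ k₂ M N).map (algebraMap ℝ ℂ) *ᵥ v)) + extend _ v) ξ := by
  rw [schurCC, Matrix.map_sub _ (by simp), Matrix.mul_assoc, Matrix.map_mul, Matrix.sub_mulVec,
    ← Matrix.mulVec_mulVec, sub_eq_add_neg, ← Matrix.mulVec_neg, Pi.add_apply, hCC, hCA,
    stencilH_mulVec, stencilH_mulVec, lap_add]
  ring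

theorem lap_harmonic_extension {k₁ k₂ : ℝ} (hk : 0 < k₁ + 4 * k₂) (M N : ℕ)
    (v : contDom M N → ℂ) {x : ℤ} (hx : x ∈ atomDom M) : lap
      (extend _ (-(((hAA k₁ k₂ M)⁻¹ * hAC k₁ k₂ M N).map (algebraMap ℝ ℂ) *ᵥ v)) + extend _ v) x
      = 0 := by
  have hk' : (k₁ + 4 * k₂ : ℂ) ≠ 0 := by exact_mod_cast hk.ne'
  have := congrFun (mulVec_extension (isUnit_hAA hk M) (hAC k₁ k₂ M N) v) ⟨x, hx⟩
  rw [Pi.add_apply, hAA, hAC, stencilH_mulVec, stencilH_mulVec, ← mul_add, ← lap_add] at this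
  exact (mul_eq_zero.1 this).resolve_left (neg_ne_zero.2 hk')

theorem extend_add_extend_of_notMem {A B : Finset ℤ} (p : A → ℂ) (v : B → ℂ) {x : ℤ}
    (hA : x ∉ A) : (extend A p + extend B v) x = extend B v x := by
  rw [Pi.add_apply, extend_of_notMem p hA, zero_add]

/-- The two domains together fill `{-N, …, N}`, so Dirichlet uniqueness applies to the glued
function, which agrees with `v` on the continuum sites. -/
theorem eq_zero_of_lap_extend {M N : ℕ} (hMN : M < N) (p : atomDom M → ℂ) (v : contDom M N → ℂ)
    (ha : ∀ x ∈ atomDom M, lap (extend _ p + extend _ v) x = 0)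
    (hc : ∀ x ∈ contDom M N, lap (extend _ p + extend _ v) x = 0) : v = 0 := by
  refine eq_zero_of_extend fun x hx => ?_
  have hxA : x ∉ atomDom M := by rw [mem_contDom] at hx; rw [mem_atomDom]; omega
  rw [← extend_add_extend_of_notMem p v hxA]
  have out : ∀ y : ℤ, y < -N ∨ N < y → (extend _ p + extend _ v) y = 0 := fun y hy => by
    rw [extend_add_extend_of_notMem p v (by rw [mem_atomDom]; omega),
      extend_of_notMem v (by rw [mem_contDom]; omega)]
  rw [mem_contDom] at hx
  refine eq_zero_of_lap_eq_zero N _ (out _ (by omega)) (out _ (by omega))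
    (fun y hy hy' => ?_) x (by omega) (by omega)
  by_cases h : y ∈ atomDom M
  · exact ha y h
  · refine hc y ?_
    rw [mem_atomDom] at h
    rw [mem_contDom]
    omega

theorem isUnit_schurCC {k₁ k₂ : ℝ} (hk : 0 < k₁ + 4 * k₂) {M N : ℕ} (hMN : M < N) :
    IsUnit (schurCC k₁ k₂ M N) := by
  have hk' : (k₁ + 4 * k₂ : ℂ) ≠ 0 := by exact_mod_cast hk.ne'
  refine isUnit_of_complex_injective _ fun v hv => eq_zero_of_lap_extend hMN _ v
    (fun x hx => lap_harmonic_extension hk M N v hx) fun x hx => ?_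
  have := congrFun hv ⟨x, hx⟩
  rw [schurCC_mulVec] at this
  exact (mul_eq_zero.1 this).resolve_left (neg_ne_zero.2 hk')

/-! ### The interface argument and the spectral radius. -/

/-- If `U` is harmonic on `{-M, …, M}`, `W` solves the second-neighbour equation there with the same
outer values, and `μ Δ U = Δ (U - W)` on the neighbouring sites with `1 ≤ ‖μ‖`, then `U = W`. -/
theorem eq_of_interface {k₁ k₂ : ℝ} (hk₂ : k₂ < 0) (hk : 0 < k₁ + 4 * k₂) (M : ℕ)
    (U W : ℤ → ℂ) (μ : ℂ) (hμ : 1 ≤ ‖μ‖) (hout : ∀ x : ℤ, x < -M ∨ M < x → U x = W x)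
    (hU : ∀ x : ℤ, -M ≤ x → x ≤ M → lap U x = 0)
    (hW : ∀ x : ℤ, -M ≤ x → x ≤ M → hnlOp k₁ k₂ W x = 0)
    (hr : μ * lap U (M + 1) = lap (U - W) (M + 1))
    (hl : μ * lap U (-M - 1) = lap (U - W) (-M - 1)) : U = W := by
  -- Subtracting `lap U (±(M + 1))` at `±(M + 2)` replaces `U` there by its affine continuation.
  set z : ℤ → ℂ := fun x => U x - W x
    - (if x = M + 2 then lap U (M + 1) else 0) - (if x = -M - 2 then lap U (-M - 1) else 0) with hz
  have zin : ∀ x : ℤ, -M - 2 < x → x < M + 2 → z x = U x - W x := fun x h h' => by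
    simp only [hz]; rw [if_neg (by omega), if_neg (by omega)]; ring
  have zr : z (M + 2) = -lap U (M + 1) := by
    simp only [hz]
    rw [if_pos trivial, if_neg (by omega), hout _ (by omega)]; ring
  have zl : z (-M - 2) = -lap U (-M - 1) := by
    simp only [hz]
    rw [if_pos trivial, if_neg (by omega), hout _ (by omega)]; ring
  -- `U - W` vanishes outside `{-M, …, M}`, so its Laplacian at `M + 1` is its value at `M`.
  have zM : z M = -(μ * z (M + 2)) := by
    rw [zr, mul_neg, neg_neg, hr, zin _ (by omega) (by omega), lap]
    simp only [Pi.sub_apply]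
    rw [hout (M + 1) (by omega), hout (M + 1 + 1) (by omega), add_sub_cancel_right]; ring
  have zM' : z (-M) = -(μ * z (-M - 2)) := by
    rw [zl, mul_neg, neg_neg, hl, zin _ (by omega) (by omega), lap]
    simp only [Pi.sub_apply]
    rw [hout (-M - 1) (by omega), hout (-M - 1 - 1) (by omega), sub_add_cancel]; ring
  have key := eq_zero_of_boundary_le hk₂ hk M z
    (by rw [zin _ (by omega) (by omega), hout _ (by omega), sub_self])
    (by rw [zin _ (by omega) (by omega), hout _ (by omega), sub_self])
    (fun x hx hx' => ?_) ?_
  · funext x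
    by_cases h : x < -M ∨ M < x
    · exact hout x h
    · have := key x (by omega) (by omega)
      rwa [zin x (by omega) (by omega), sub_eq_zero] at this
  · -- the harmonic continuation of `U` to the second layer solves the second-neighbour equation
    have hsplit : U (x + 2) - (if x + 2 = M + 2 then lap U (M + 1) else 0)
        = 2 * U (x + 1) - U x := by
      split_ifs with h
      · rw [show (M : ℤ) + 1 = x + 1 by omega, lap, add_sub_cancel_right, add_assoc,
          one_add_one_eq_two]
        ring
      · have := hU (x + 1) (by omega) (by omega)
        rw [lap, add_sub_cancel_right, add_assoc, one_add_one_eq_two] at this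
        linear_combination this
    have hsplit' : U (x - 2) - (if x - 2 = -M - 2 then lap U (-M - 1) else 0)
        = 2 * U (x - 1) - U x := by
      split_ifs with h
      · rw [show -(M : ℤ) - 1 = x - 1 by omega, lap, sub_add_cancel, sub_sub,
          one_add_one_eq_two]
        ring
      · have := hU (x - 1) (by omega) (by omega)
        rw [lap, sub_add_cancel, sub_sub, one_add_one_eq_two] at this
        linear_combination this
    have e2 : z (x + 2) = 2 * U (x + 1) - U x - W (x + 2) := by
      rw [← hsplit]; simp only [hz]
      rw [if_neg (show ¬ x + 2 = -M - 2 by omega)]; ring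
    have e2' : z (x - 2) = 2 * U (x - 1) - U x - W (x - 2) := by
      rw [← hsplit']; simp only [hz]
      rw [if_neg (show ¬ x - 2 = M + 2 by omega)]; ring
    have h1 := hU x hx hx'
    have h2 := hW x hx hx'
    rw [lap] at h1
    rw [hnlOp, lap] at h2 ⊢
    rw [e2, e2', zin x (by omega) (by omega), zin (x + 1) (by omega) (by omega),
      zin (x - 1) (by omega) (by omega)]
    linear_combination (-k₁ - 2 * k₂ : ℂ) * h1 - h2
  · rw [zM, zM', norm_neg, norm_neg, norm_mul, norm_mul, mul_pow, mul_pow]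
    have : 1 ≤ ‖μ‖ ^ 2 := one_le_pow₀ hμ
    nlinarith [sq_nonneg ‖z (M + 2)‖, sq_nonneg ‖z (-M - 2)‖]

theorem specRad_iterOp_lt_one {k₁ k₂ : ℝ} (hk₂ : k₂ < 0) (hk : 0 < k₁ + 4 * k₂) {M N : ℕ}
    (hMN : M < N) : specRad (iterOp k₁ k₂ M N) < 1 := by
  have hk' : (-(k₁ + 4 * k₂) : ℂ) ≠ 0 := neg_ne_zero.2 (by exact_mod_cast hk.ne')
  refine specRad_lt_one _ fun μ f hf hμ => ?_
  have hμ0 : μ ≠ 0 := by rintro rfl; norm_num at hμ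
  obtain ⟨a, v, rfl⟩ : ∃ a v, f = Sum.elim a v := ⟨f ∘ Sum.inl, f ∘ Sum.inr, by simp⟩
  rw [iterOp_eq_fromBlocks, Matrix.fromBlocks_map, Matrix.fromBlocks_mulVec] at hf
  have hfa : (-((hnlAA k₁ k₂ M)⁻¹ * hnlAC k₁ k₂ M N)).map (algebraMap ℝ ℂ) *ᵥ v = μ • a := by
    funext x
    simpa [Matrix.map_zero] using congrFun hf (Sum.inl x)
  have hfc : (1 - (schurCC k₁ k₂ M N)⁻¹ * (hCC k₁ k₂ M N - hCA k₁ k₂ M N * (hnlAA k₁ k₂ M)⁻¹ *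
      hnlAC k₁ k₂ M N)).map (algebraMap ℝ ℂ) *ᵥ v = μ • v := by
    funext x
    simpa [Matrix.map_zero] using congrFun hf (Sum.inr x)
  -- The atomistic part is determined by `v`, because `μ ≠ 0`.
  suffices hv : v = 0 by
    rw [hv, Matrix.mulVec_zero] at hfa
    rw [hv, (smul_eq_zero.1 hfa.symm).resolve_left hμ0]
    funext x; cases x <;> rfl
  have hS : (schurCC k₁ k₂ M N).map (algebraMap ℝ ℂ) *ᵥ v
      - (hCC k₁ k₂ M N).map (algebraMap ℝ ℂ) *ᵥ v
      + (hCA k₁ k₂ M N).map (algebraMap ℝ ℂ) *ᵥ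
        (((hnlAA k₁ k₂ M)⁻¹ * hnlAC k₁ k₂ M N).map (algebraMap ℝ ℂ) *ᵥ v)
      = μ • ((schurCC k₁ k₂ M N).map (algebraMap ℝ ℂ) *ᵥ v) := by
    have := congrArg (fun w => (schurCC k₁ k₂ M N).map (algebraMap ℝ ℂ) *ᵥ w) hfc
    rw [Matrix.mulVec_mulVec, ← Matrix.map_mul, Matrix.mul_sub, Matrix.mul_one,
      Matrix.mul_nonsing_inv_cancel_left _ _
        ((Matrix.isUnit_iff_isUnit_det _).1 (isUnit_schurCC hk hMN)),
      Matrix.map_sub _ (by simp), Matrix.map_sub _ (by simp), Matrix.mul_assoc,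
      Matrix.map_mul (L := hCA k₁ k₂ M N), Matrix.sub_mulVec, Matrix.sub_mulVec,
      ← Matrix.mulVec_mulVec, Matrix.mulVec_smul] at this
    rw [← this]; abel
  set p := -(((hAA k₁ k₂ M)⁻¹ * hAC k₁ k₂ M N).map (algebraMap ℝ ℂ) *ᵥ v) with hp
  set w := -(((hnlAA k₁ k₂ M)⁻¹ * hnlAC k₁ k₂ M N).map (algebraMap ℝ ℂ) *ᵥ v) with hw
  set U := extend _ p + extend _ v with hUdef
  set W := extend _ w + extend _ v with hWdef
  have hU : ∀ x ∈ atomDom M, lap U x = 0 := fun x hx => lap_harmonic_extension hk M N v hx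
  have hW : ∀ x ∈ atomDom M, hnlOp k₁ k₂ W x = 0 := by
    intro x hx
    have := congrFun (mulVec_extension (isUnit_hnlAA hk₂ hk M) (hnlAC k₁ k₂ M N) v) ⟨x, hx⟩
    rwa [Pi.add_apply, hnlAA, hnlAC, stencilHnl_mulVec, stencilHnl_mulVec, ← hnlOp_add] at this
  -- Both the Schur complement and its second-neighbour analogue act on `v` as a multiple of the
  -- Laplacian, of `U` and of `W` respectively.
  have hc : ∀ x ∈ contDom M N, μ * lap U x = lap (U - W) x := by
    intro x hx
    have := congrFun hS ⟨x, hx⟩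
    rw [← neg_neg ((((hnlAA k₁ k₂ M)⁻¹ * hnlAC k₁ k₂ M N).map (algebraMap ℝ ℂ) *ᵥ v)), ← hw,
      Matrix.mulVec_neg, Pi.add_apply, Pi.sub_apply, Pi.neg_apply, Pi.smul_apply, schurCC_mulVec,
      hCC, hCA, stencilH_mulVec, stencilH_mulVec, smul_eq_mul, ← hp, ← hUdef] at this
    apply mul_left_cancel₀ hk'
    have hWx : lap W x = lap (extend _ w) x + lap (extend _ v) x := lap_add _ _ x
    rw [lap_sub]
    linear_combination -this - (k₁ + 4 * k₂ : ℂ) * hWx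
  have hUW : U = W := by
    refine eq_of_interface hk₂ hk M U W μ hμ (fun x hx => ?_)
      (fun x h h' => hU x (mem_atomDom.2 ⟨h, h'⟩)) (fun x h h' => hW x (mem_atomDom.2 ⟨h, h'⟩))
      (hc _ (mem_contDom.2 (by omega))) (hc _ (mem_contDom.2 (by omega)))
    have hxA : x ∉ atomDom M := by rw [mem_atomDom]; omega
    rw [hUdef, hWdef, extend_add_extend_of_notMem _ _ hxA, extend_add_extend_of_notMem _ _ hxA]
  refine eq_zero_of_lap_extend hMN p v hU fun x hx => ?_
  have := hc x hx
  rw [hUW, lap_sub, sub_self] at this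
  rw [← hUdef, hUW]
  exact (mul_eq_zero.1 this).resolve_left hμ0

end Sinclair

theorem theorem2 (k₁ k₂ : ℝ) (hk₁ : 0 < k₁) (hk₂ : k₂ < 0) (hk : 0 < k₁ + 4 * k₂)
    (M N : ℕ) (hMN : M < N) :
    -- the operators that the iteration inverts are invertible
    IsUnit (Sinclair.hnlAA k₁ k₂ M) ∧
    IsUnit (Sinclair.hAA k₁ k₂ M) ∧
    IsUnit (Sinclair.schurCC k₁ k₂ M N) ∧
    -- the spectral radius is strictly less than one
    Sinclair.specRad (Sinclair.iterOp k₁ k₂ M N) < 1 :=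
  ⟨Sinclair.isUnit_hnlAA hk₂ hk M, Sinclair.isUnit_hAA hk M, Sinclair.isUnit_schurCC hk hMN,
    Sinclair.specRad_iterOp_lt_one hk₂ hk hMN⟩
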